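/- Let $A$ be a $C^*$-algebra, and equip $M_n(A)$ with its $C^*$-norm. For an integer $d\ge 1$ say that $A$ has length $\le d$ if there is a constant $K$ such that for every $n$ and every $x\in M_n(A)$ there are an integer $N=N(n,x)$, scalar matrices $\alpha_0\in M_{n,N}(\mathbb C)$, $\alpha_1,\dots,\alpha_{d-1}\in M_N(\mathbb C)$, $\alpha_d\in M_{N,n}(\mathbb C)$ and diagonal matrices $D_1,\dots,D_d\in M_N(A)$ with $$x=\alpha_0D_1\alpha_1D_2\cdots D_d\alpha_d,\qquad \prod_{i=0}^d\|\alpha_i\|\prod_{i=1}^d\|D_i\|\le K\|x\|,$$ where scalar matrices carry the operator norm; the length $\ell(A)$ is the smallest such $d$ (and $\infty$ if there is none). For a set $I$, let $\ell_\infty(I,A)$ be the $C^*$-algebra of all bounded families $(x_i)_{i\in I}$ in $A$ with norm $\sup_i\|x_i\|$. Proposition. Let $C$ be the CAR algebra $C=M_2^{\otimes\mathbb N}$, or, more generally, any infinite $C^*$-tensor product $C=\bigotimes_{j\in J}M_{n_j}$ of matrix algebras, that is, the $C^*$-algebra inductive limit of the finite tensor products $\bigotimes_{j\in F}M_{n_j}$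 over finite $F\subset J$ under the maps $b\mapsto b\otimes 1$, where $n_j\ge 1$ for all $j$ and $n_j\ge2$ for infinitely many $j$. Then $\ell(\ell_\infty(I,C))\le 5$ for every set $I$. -/

import Mathlib

open scoped ENNReal Matrix.Norms.L2Operator

noncomputable section

/-! ### Length of a C⋆-algebra -/

namespace OpLength

/-- Left multiplication of a matrix over `A` by a scalar matrix. -/
def scalarMul {A : Type*} [NonUnitalCStarAlgebra A] {l m k : Type*} [Fintype m]
    (α : Matrix l m ℂ) (M : Matrix m k A) : Matrix l k A :=
  fun i j => ∑ t, α i t • M t j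

/-- Right multiplication of a matrix over `A` by a scalar matrix. -/
def mulScalar {A : Type*} [NonUnitalCStarAlgebra A] {l m k : Type*} [Fintype m]
    (M : Matrix l m A) (α : Matrix m k ℂ) : Matrix l k A :=
  fun i j => ∑ t, α t j • M i t

/-- The C⋆-norm of `M_n(A)`, for a C⋆-algebra `A`: the operator norm of a matrix acting on the
Hilbert C⋆-module `A^n`. (The order on `A`, which Mathlib needs to speak of Hilbert C⋆-modules,
is the usual one: nonnegative elements are the selfadjoint ones with nonnegative spectrum.) -/
def matNorm {A : Type*} [NonUnitalCStarAlgebra A] {m : Type*} [Fintype m]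
    (M : Matrix m m A) : ℝ :=
  letI : PartialOrder A := CStarAlgebra.spectralOrder A
  haveI : StarOrderedRing A := CStarAlgebra.spectralOrderedRing A
  ‖CStarMatrix.ofMatrix M‖

/-- `diagWord α D k = D₀ α₀ D₁ α₁ ⋯ αₖ₋₁ Dₖ`, where `Dᵢ` is the diagonal matrix with entries
`D i`: an alternating product with `k + 1` diagonal factors over `A`. -/
def diagWord {A : Type*} [NonUnitalCStarAlgebra A] {N : ℕ}
    (α : ℕ → Matrix (Fin N) (Fin N) ℂ) (D : ℕ → Fin N → A) : ℕ → Matrix (Fin N) (Fin N) A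
  | 0 => Matrix.diagonal (D 0)
  | k + 1 => mulScalar (diagWord α D k) (α k) * Matrix.diagonal (D (k + 1))

/-- `A` has the factorization property with `d = k + 1` diagonal factors: there is a constant `K`
such that every `x ∈ M_n(A)` can be written as `x = β D₀ α₀ D₁ ⋯ αₖ₋₁ Dₖ γ` with scalar
matrices `β` (of size `n × N`), `αᵢ` (of size `N × N`), `γ` (of size `N × n`) and diagonal
matrices `Dᵢ ∈ M_N(A)`, the product of all their norms being at most `K ‖x‖`. -/
def HasLengthLE (A : Type*) [NonUnitalCStarAlgebra A] (d : ℕ) : Prop :=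
  ∃ k : ℕ, d = k + 1 ∧ ∃ K : ℝ, ∀ (n : ℕ) (x : Matrix (Fin n) (Fin n) A),
    ∃ (N : ℕ) (β : Matrix (Fin n) (Fin N) ℂ) (γ : Matrix (Fin N) (Fin n) ℂ)
      (α : ℕ → Matrix (Fin N) (Fin N) ℂ) (D : ℕ → Fin N → A),
      x = scalarMul β (mulScalar (diagWord α D k) γ) ∧
      (‖β‖ * (∏ i ∈ Finset.range k, ‖α i‖) * ‖γ‖) *
        (∏ i ∈ Finset.range (k + 1), matNorm (Matrix.diagonal (D i))) ≤ K * matNorm x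

/-- The length `ℓ(A)`: the smallest `d ≥ 1` with the factorization property (`⊤` if none). -/
def length (A : Type*) [NonUnitalCStarAlgebra A] : ℕ∞ :=
  sInf {e : ℕ∞ | ∃ d : ℕ, HasLengthLE A d ∧ e = d}

end OpLength

/-! ### Infinite C⋆-tensor products of matrix algebras -/

namespace InfTensor

variable {J : Type*} [DecidableEq J] (n : J → ℕ) [∀ j, NeZero (n j)]

/-- Indices of the canonical orthonormal basis of the infinite tensor product of the Hilbert
spaces `ℂ^{n j}` along the vectors `e₀`: families `f` with `f j = 0` for all but finitely many
`j`, the basis vector of `f` being `⨂ⱼ e_{f j}`. -/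
abbrev Config : Type _ := Π₀ j, Fin (n j)

/-- The Hilbert space `⨂ⱼ (ℂ^{n j}, e₀)`. -/
abbrev Space : Type _ := lp (fun _ : Config n => ℂ) 2

variable {n}

/-- Coordinates of the image of `ξ` under the matrix unit `e_{rs}` in position `j`. -/
def unitFun (j : J) (r s : Fin (n j)) (ξ : Config n → ℂ) : Config n → ℂ :=
  fun f => if f j = r then ξ (f.update j s) else 0

lemma update_injOn (j : J) (r s : Fin (n j)) :
    Function.Injective (fun f : {f : Config n // f j = r} => f.1.update j s) := by
  rintro ⟨f, hf⟩ ⟨g, hg⟩ h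
  ext i : 2
  by_cases hi : i = j
  · subst hi; simp [hf, hg]
  · simpa [Function.update_of_ne hi] using DFunLike.congr_fun h i

lemma unitFun_summable (j : J) (r s : Fin (n j)) (ξ : Space n) :
    Summable (fun f => ‖unitFun j r s ξ f‖ ^ (2 : ℝ)) ∧
      ∑' f, ‖unitFun j r s ξ f‖ ^ (2 : ℝ) ≤ ∑' f, ‖ξ f‖ ^ (2 : ℝ) := by
  have hξ : Summable (fun f => ‖ξ f‖ ^ (2 : ℝ)) := by
    simpa using (lp.memℓp ξ).summable (by norm_num)
  have h0 : (fun f => ‖unitFun j r s ξ f‖ ^ (2 : ℝ)) =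
      Set.indicator {f : Config n | f j = r} (fun f => ‖ξ (f.update j s)‖ ^ (2 : ℝ)) := by
    ext f
    by_cases h : f j = r <;> simp [unitFun, h]
  have hs := hξ.comp_injective (update_injOn j r s)
  rw [h0]
  refine ⟨summable_subtype_iff_indicator.1 hs, ?_⟩
  rw [← tsum_subtype]
  exact hs.tsum_le_tsum_of_inj _ (update_injOn j r s)
    (fun c _ => by positivity) (fun _ => le_rfl) hξ

/-- The matrix unit `e_{rs}` acting in position `j` (and trivially in the other positions):
it maps `⨂ᵢ e_{f i}` to the same tensor with `e_r` in position `j` if `f j = s`, and to `0`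
otherwise. -/
def unitOp (j : J) (r s : Fin (n j)) : Space n →L[ℂ] Space n :=
  LinearMap.mkContinuous
    { toFun := fun ξ => ⟨unitFun j r s ξ,
        memℓp_gen (by simpa using (unitFun_summable j r s ξ).1)⟩
      map_add' := fun ξ η => by
        ext f
        change unitFun j r s (ξ + η : Space n) f = unitFun j r s ξ f + unitFun j r s η f
        by_cases h : f j = r <;> simp [unitFun, h]
      map_smul' := fun c ξ => by
        ext f; by_cases h : f j = r <;> simp [unitFun, h] }
    1 (fun ξ => by
      rw [one_mul]
      have h2 : (0 : ℝ) < (2 : ℝ≥0∞).toReal := by norm_num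
      rw [← Real.rpow_le_rpow_iff (norm_nonneg _) (norm_nonneg _) h2,
        lp.norm_rpow_eq_tsum h2, lp.norm_rpow_eq_tsum h2]
      simpa using (unitFun_summable j r s ξ).2)

@[simp] lemma unitOp_apply (j : J) (r s : Fin (n j)) (ξ : Space n) (f : Config n) :
    unitOp j r s ξ f = if f j = r then ξ (f.update j s) else 0 := rfl

lemma unitOp_mul (j : J) (r s t u : Fin (n j)) :
    unitOp j r s * unitOp j t u = if s = t then unitOp j r u else 0 := by
  ext ξ f
  rw [mul_apply_eq_comp, unitOp_apply]
  by_cases hr : f j = r <;> by_cases hst : s = t <;> simp [hr, hst]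
  refine congrArg (fun g : Config n => ξ g) ?_
  ext i : 2
  by_cases hi : i = j
  · subst hi; simp
  · simp [Function.update_of_ne hi]

lemma sum_unitOp (j : J) : ∑ r, unitOp j r r = (1 : Space n →L[ℂ] Space n) := by
  ext ξ f
  have h (r : Fin (n j)) : unitOp j r r ξ f = if f j = r then ξ f else 0 := by
    rw [unitOp_apply]
    split_ifs with h
    · subst h
      refine congrArg (fun g : Config n => ξ g) ?_
      ext i : 2
      by_cases hi : i = j
      · subst hi; simp
      · simp
    · rfl
  rw [sum_apply, lp.coeFn_sum, Finset.sum_apply]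
  simp [h]

lemma star_unitOp (j : J) (r s : Fin (n j)) :
    star (unitOp j r s) = (unitOp j s r : Space n →L[ℂ] Space n) := by
  rw [ContinuousLinearMap.star_eq_adjoint, eq_comm, ContinuousLinearMap.eq_adjoint_iff]
  intro ξ η
  rw [lp.inner_eq_tsum, lp.inner_eq_tsum]
  have key : ∀ (a : Fin (n j)) (F : Config n → ℂ),
      ∑' f, (if f j = a then F f else 0) = ∑' f : {f : Config n // f j = a}, F f := by
    intro a F
    refine Eq.trans (tsum_congr fun f => ?_) (tsum_subtype {f : Config n | f j = a} F).symm
    by_cases h : f j = a <;> simp [h]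
  let e : {f : Config n // f j = s} ≃ {f : Config n // f j = r} :=
    { toFun := fun f => ⟨f.1.update j r, by simp⟩
      invFun := fun f => ⟨f.1.update j s, by simp⟩
      left_inv := by
        rintro ⟨f, hf⟩
        ext i : 3
        by_cases hi : i = j
        · subst hi; simp [hf]
        · simp [Function.update_of_ne hi]
      right_inv := by
        rintro ⟨f, hf⟩
        ext i : 3
        by_cases hi : i = j
        · subst hi; simp [hf]
        · simp [Function.update_of_ne hi] }
  have h1 : ∀ f, inner ℂ (unitOp j s r ξ f) (η f) =
      if f j = s then inner ℂ (ξ (f.update j r)) (η f) else 0 := by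
    intro f; rw [unitOp_apply]; split_ifs <;> simp
  have h2 : ∀ f, inner ℂ (ξ f) (unitOp j r s η f) =
      if f j = r then inner ℂ (ξ f) (η (f.update j s)) else 0 := by
    intro f; rw [unitOp_apply]; split_ifs <;> simp
  simp_rw [h1, h2]
  rw [key s, key r, ← e.tsum_eq]
  refine tsum_congr fun f => ?_
  congr 1
  exact congrArg (fun g : {f : Config n // f j = s} => η g.1) (e.left_inv f).symm

variable (n) in
/-- The canonical embedding `a ↦ ⋯ ⊗ 1 ⊗ a ⊗ 1 ⊗ ⋯` (with `a` in position `j`) of the matrix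
algebra `M_{n j}`, as a unital `⋆`-homomorphism into the bounded operators on
`⨂ⱼ (ℂ^{n j}, e₀)`. -/
def siteRep (j : J) : Matrix (Fin (n j)) (Fin (n j)) ℂ →⋆ₐ[ℂ] (Space n →L[ℂ] Space n) :=
  { AlgHom.ofLinearMap
      ({ toFun := fun a => ∑ r, ∑ s, a r s • unitOp j r s
         map_add' := fun a b => by simp [add_smul, Finset.sum_add_distrib]
         map_smul' := fun c a => by simp [Finset.smul_sum, mul_smul] } :
        Matrix (Fin (n j)) (Fin (n j)) ℂ →ₗ[ℂ] (Space n →L[ℂ] Space n))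
      (by
        change ∑ r, ∑ s, (1 : Matrix (Fin (n j)) (Fin (n j)) ℂ) r s • unitOp j r s = 1
        simp [Matrix.one_apply, ite_smul, sum_unitOp])
      (fun a b => by
        change ∑ r, ∑ s, (a * b) r s • unitOp j r s =
          (∑ r, ∑ s, a r s • unitOp j r s) * (∑ r, ∑ s, b r s • unitOp j r s)
        simp only [Finset.sum_mul]
        simp only [Finset.mul_sum, smul_mul_smul_comm, unitOp_mul, smul_ite, smul_zero,
          Matrix.mul_apply, Finset.sum_smul]
        refine Finset.sum_congr rfl fun r _ => ?_
        rw [Finset.sum_comm]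
        refine Finset.sum_congr rfl fun s _ => ?_
        rw [Finset.sum_comm]
        simp) with
    map_star' := fun a => by
      change ∑ r, ∑ s, (star a) r s • unitOp j r s = star (∑ r, ∑ s, a r s • unitOp j r s)
      simp only [star_sum, star_smul, star_unitOp, Matrix.star_apply]
      rw [Finset.sum_comm] }

end InfTensor

/-- The infinite C⋆-tensor product `⨂ⱼ M_{n j}` of matrix algebras: the C⋆-algebra generated by
the commuting copies `⋯ ⊗ 1 ⊗ M_{n j} ⊗ 1 ⊗ ⋯`, `j ∈ J`, in their representation on
`⨂ⱼ (ℂ^{n j}, e₀)`. It is the norm closure of the increasing union of the finite tensor products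
`⨂_{j ∈ F} M_{n j}`, which are simple, hence carry their unique C⋆-norm. -/
def matrixTensorSubalgebra {J : Type*} [DecidableEq J] (n : J → ℕ) [∀ j, NeZero (n j)] :
    StarSubalgebra ℂ (InfTensor.Space n →L[ℂ] InfTensor.Space n) :=
  (StarAlgebra.adjoin ℂ (⋃ j, Set.range (InfTensor.siteRep n j))).topologicalClosure

/-- The infinite C⋆-tensor product `⨂ⱼ M_{n j}`, as a type. -/
abbrev MatrixTensor {J : Type*} [DecidableEq J] (n : J → ℕ) [∀ j, NeZero (n j)] : Type _ :=
  matrixTensorSubalgebra n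

instance matrixTensorCStarAlgebra {J : Type*} [DecidableEq J] (n : J → ℕ) [∀ j, NeZero (n j)] :
    CStarAlgebra (MatrixTensor n) :=
  StarSubalgebra.cstarAlgebra (matrixTensorSubalgebra n)
    (h_closed := StarSubalgebra.isClosed_topologicalClosure _)

/-- The CAR algebra `M₂^{⊗ℕ}`. -/
abbrev CARAlgebra : Type := MatrixTensor (fun _ : ℕ => 2)

/-- The C⋆-algebra `ℓ_∞(I, C)` of bounded families in `C`, with the sup norm. -/
abbrev BddFamilies (I : Type*) (C : Type*) [CStarAlgebra C] : Type _ := lp (fun _ : I => C) ∞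

end

/-! ### Operator norms of scalar matrices and of diagonal matrices -/

namespace OpLength

section ScalarNorm

variable {l m k : Type*} [Fintype l] [Fintype m] [Fintype k] [DecidableEq l] [DecidableEq m]
  [DecidableEq k]

/-! Four diagonal factors already suffice, with the constant 2 · 4⁵ for every I. A finite family in
C lies, up to any prescribed error, in a finite tensor product, so it nearly commutes with matrix
units of any size taken from unused sites.

Suppose the entries of y ∈ M_n(A) commute with n × n matrix units e_{ij}, and let p = ∑ e_{ii}. Then
y is encoded by the single element X = ∑ e_{r0} y_{rs} e_{0s}. This is a compression of y, so ‖X‖ ≤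
‖y‖ (`norm_compression_le`). It returns y through ∑_k e_{ki} X e_{jk} = p y_{ij} (`sum_mul_eq`).

To make this a short word, each e_{ki} is expanded in products W_g W_h of copies of Weyl unitaries;
the coefficients from (g,i) to (h,k) form n⁻² times a contraction (`norm_flipMatrix_le`,
`e_eq_sum_flipMatrix`). Each side of X then costs two diagonal factors, X is absorbed into one of
them, and the sum over k becomes a scalar projection. No norm depends on n
(`hasFourFactorization_sandwich`).

Since n need not divide the size of the available matrix units, p may differ from 1. Two
contractions with a₀⋆ p a₀ + a₁⋆ p a₁ = 1 repair this (`IsMatrixUnits.exists_cover`). The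
approximation error is so small that a crude factorization handles it. All bounds are uniform, so
the choices can be made coordinatewise in ℓ_∞(I, C). -/

lemma norm_le_one_of_isIdempotent {E : Type*} [NonUnitalNormedRing E] [StarRing E] [CStarRing E]
    {p : E} (hs : star p = p) (hp : p * p = p) : ‖p‖ ≤ 1 := by
  have h : ‖p‖ * ‖p‖ = ‖p‖ := by
    rw [← CStarRing.norm_star_mul_self, hs, hp]
  nlinarith [norm_nonneg p]

lemma norm_le_one_of_star_mul_self {E : Type*} [NonUnitalNormedRing E] [StarRing E] [CStarRing E]
    {a : E} (h : star a * a * (star a * a) = star a * a) : ‖a‖ ≤ 1 := by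
  have h1 := norm_le_one_of_isIdempotent (p := star a * a) (by simp) h
  rw [CStarRing.norm_star_mul_self] at h1
  nlinarith [norm_nonneg a]

lemma norm_le_one_of_mul_conjTranspose {M : Matrix l m ℂ} (h : M * M.conjTranspose = 1) :
    ‖M‖ ≤ 1 := by
  have h1 : ‖M.conjTranspose.conjTranspose * M.conjTranspose‖ ≤ 1 := by
    rw [Matrix.conjTranspose_conjTranspose, h]
    exact norm_le_one_of_isIdempotent (by simp) (by simp)
  rw [Matrix.l2_opNorm_conjTranspose_mul_self, Matrix.l2_opNorm_conjTranspose] at h1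
  nlinarith [norm_nonneg M]

lemma norm_conjTranspose_le {M : Matrix l m ℂ} {b : ℝ} (h : ‖M‖ ≤ b) :
    ‖M.conjTranspose‖ ≤ b := by
  rwa [Matrix.l2_opNorm_conjTranspose]

/-- Reindexing is multiplication by permutation matrices. This allows words indexed by arbitrary
finite types, transported to `Fin N` only at the end. -/
lemma norm_submatrix_equiv_le {l' m' : Type*} [Fintype l'] [Fintype m'] [DecidableEq l']
    [DecidableEq m'] (M : Matrix l m ℂ) (e : l' ≃ l) (f : m' ≃ m) :
    ‖M.submatrix e f‖ ≤ ‖M‖ := by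
  have h : M.submatrix e f = (1 : Matrix l l ℂ).submatrix e id * M *
      (1 : Matrix m m ℂ).submatrix id f := by
    ext i j
    simp [Matrix.mul_apply, Matrix.one_apply]
  have h1 : ‖(1 : Matrix l l ℂ).submatrix e id‖ ≤ 1 := by
    apply norm_le_one_of_mul_conjTranspose
    ext i j
    simp [Matrix.mul_apply, Matrix.one_apply, eq_comm]
  have h2 : ‖(1 : Matrix m m ℂ).submatrix id f‖ ≤ 1 := by
    rw [← Matrix.l2_opNorm_conjTranspose]
    apply norm_le_one_of_mul_conjTranspose
    ext i j
    simp [Matrix.mul_apply, Matrix.one_apply]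
  rw [h]
  calc _ ≤ ‖(1 : Matrix l l ℂ).submatrix e id‖ * ‖M‖ * ‖(1 : Matrix m m ℂ).submatrix id f‖ :=
        (Matrix.l2_opNorm_mul _ _).trans
          (mul_le_mul_of_nonneg_right (Matrix.l2_opNorm_mul _ _) (norm_nonneg _))
    _ ≤ 1 * ‖M‖ * 1 := by gcongr
    _ = ‖M‖ := by ring

lemma norm_inl_le_one : ‖Matrix.fromCols (1 : Matrix l l ℂ) (0 : Matrix l m ℂ)‖ ≤ 1 := by
  apply norm_le_one_of_mul_conjTranspose
  rw [Matrix.conjTranspose_fromCols_eq_fromRows_conjTranspose, Matrix.fromCols_mul_fromRows]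
  simp

lemma norm_inr_le_one : ‖Matrix.fromCols (0 : Matrix m l ℂ) (1 : Matrix m m ℂ)‖ ≤ 1 := by
  apply norm_le_one_of_mul_conjTranspose
  rw [Matrix.conjTranspose_fromCols_eq_fromRows_conjTranspose, Matrix.fromCols_mul_fromRows]
  simp

lemma norm_fromCols_le {o : Type*} [Fintype o] (M : Matrix o l ℂ) (M' : Matrix o m ℂ) :
    ‖Matrix.fromCols M M'‖ ≤ ‖M‖ + ‖M'‖ := by
  have h : Matrix.fromCols M M' = M * Matrix.fromCols (1 : Matrix l l ℂ) (0 : Matrix l m ℂ) +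
      M' * Matrix.fromCols (0 : Matrix m l ℂ) (1 : Matrix m m ℂ) := by
    ext i (j | j) <;> simp
  rw [h]
  refine (norm_add_le _ _).trans (add_le_add ?_ ?_)
  · exact (Matrix.l2_opNorm_mul _ _).trans
      (mul_le_of_le_one_right (norm_nonneg _) norm_inl_le_one)
  · exact (Matrix.l2_opNorm_mul _ _).trans
      (mul_le_of_le_one_right (norm_nonneg _) norm_inr_le_one)

lemma norm_fromRows_le (M : Matrix l k ℂ) (M' : Matrix m k ℂ) :
    ‖Matrix.fromRows M M'‖ ≤ ‖M‖ + ‖M'‖ := by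
  rw [← Matrix.l2_opNorm_conjTranspose,
    Matrix.conjTranspose_fromRows_eq_fromCols_conjTranspose]
  refine (norm_fromCols_le _ _).trans ?_
  rw [Matrix.l2_opNorm_conjTranspose, Matrix.l2_opNorm_conjTranspose]

lemma norm_fromBlocks_diag_le (M : Matrix l l ℂ) (M' : Matrix m m ℂ) :
    ‖Matrix.fromBlocks M 0 0 M'‖ ≤ ‖M‖ + ‖M'‖ := by
  have h : Matrix.fromBlocks M 0 0 M' =
      Matrix.fromRows (M * Matrix.fromCols (1 : Matrix l l ℂ) (0 : Matrix l m ℂ))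
        (M' * Matrix.fromCols (0 : Matrix m l ℂ) (1 : Matrix m m ℂ)) := by
    ext (i | i) (j | j) <;> simp
  rw [h]
  refine (norm_fromRows_le _ _).trans (add_le_add ?_ ?_)
  · exact (Matrix.l2_opNorm_mul _ _).trans
      (mul_le_of_le_one_right (norm_nonneg _) norm_inl_le_one)
  · exact (Matrix.l2_opNorm_mul _ _).trans
      (mul_le_of_le_one_right (norm_nonneg _) norm_inr_le_one)

end ScalarNorm

/-! ### The C⋆-norm of diagonal matrices. -/

section MatNorm

variable {A : Type*} [NonUnitalCStarAlgebra A]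

lemma matNorm_nonneg {m : Type*} [Fintype m] (M : Matrix m m A) : 0 ≤ matNorm M := by
  let : PartialOrder A := CStarAlgebra.spectralOrder A
  have : StarOrderedRing A := CStarAlgebra.spectralOrderedRing A
  exact norm_nonneg (CStarMatrix.ofMatrix M)

/-- Diagonal matrices, as a `⋆`-homomorphism. -/
def diagonalHom [PartialOrder A] [StarOrderedRing A] (m : Type*) [Fintype m] [DecidableEq m] :
    (m → A) →⋆ₙₐ[ℂ] CStarMatrix m m A where
  toFun D := CStarMatrix.ofMatrix (Matrix.diagonal D)
  map_smul' c D := by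
    ext i j
    by_cases h : i = j <;> simp [h]
  map_zero' := by
    ext i j
    simp
  map_add' D D' := by
    ext i j
    by_cases h : i = j <;> simp [h]
  map_mul' D D' := by
    ext i j
    by_cases h : i = j <;> simp [CStarMatrix.mul_apply, Matrix.diagonal_apply, h]
  map_star' D := by
    ext i j
    by_cases h : i = j
    · subst h; simp [CStarMatrix.star_apply]
    · simp [CStarMatrix.star_apply, h, Ne.symm h]

lemma matNorm_diagonal_le {m : Type*} [Fintype m] [DecidableEq m] {D : m → A} {b : ℝ}
    (hb : 0 ≤ b) (h : ∀ i, ‖D i‖ ≤ b) : matNorm (Matrix.diagonal D) ≤ b := by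
  let : PartialOrder A := CStarAlgebra.spectralOrder A
  have : StarOrderedRing A := CStarAlgebra.spectralOrderedRing A
  exact (NonUnitalStarAlgHom.norm_apply_le (diagonalHom m) D).trans
    ((pi_norm_le_iff_of_nonneg hb).2 h)

end MatNorm

end OpLength

/-! ### Factorizations with four diagonal factors -/

namespace OpLength

section Factorization

variable {A : Type*} [NonUnitalCStarAlgebra A] {n : ℕ}

/-- `x = β D₀ α₀ D₁ α₁ D₂ α₂ D₃ γ` with scalar matrices of norm at most `b`, and diagonal matrices
of norm at most `1`, except for `D₁`, whose norm is at most `M`. -/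
def HasFourFactorization (x : Matrix (Fin n) (Fin n) A) (b M : ℝ) : Prop :=
  ∃ (P : Type) (_ : Fintype P) (_ : DecidableEq P) (β : Matrix (Fin n) P ℂ)
    (γ : Matrix P (Fin n) ℂ) (α₀ α₁ α₂ : Matrix P P ℂ) (D₀ D₁ D₂ D₃ : P → A),
    (‖β‖ ≤ b ∧ ‖γ‖ ≤ b ∧ ‖α₀‖ ≤ b ∧ ‖α₁‖ ≤ b ∧ ‖α₂‖ ≤ b) ∧
    ((∀ p, ‖D₀ p‖ ≤ 1) ∧ (∀ p, ‖D₁ p‖ ≤ M) ∧ (∀ p, ‖D₂ p‖ ≤ 1) ∧ (∀ p, ‖D₃ p‖ ≤ 1)) ∧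
    ∀ i j, x i j = ∑ p, ∑ s, ∑ r, ∑ q,
      (β i p * α₀ p q * α₁ q r * α₂ r s * γ s j) • (D₀ p * D₁ q * D₂ r * D₃ s)

lemma HasFourFactorization.mono {x : Matrix (Fin n) (Fin n) A} {b M b' M' : ℝ}
    (h : HasFourFactorization x b M) (hb : b ≤ b') (hM : M ≤ M') :
    HasFourFactorization x b' M' := by
  obtain ⟨P, i1, i2, β, γ, α₀, α₁, α₂, D₀, D₁, D₂, D₃, ⟨h1, h2, h3, h4, h5⟩, ⟨h6, h7, h8, h9⟩,
    h10⟩ := h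
  exact ⟨P, i1, i2, β, γ, α₀, α₁, α₂, D₀, D₁, D₂, D₃, ⟨h1.trans hb, h2.trans hb, h3.trans hb,
    h4.trans hb, h5.trans hb⟩, ⟨h6, fun p => (h7 p).trans hM, h8, h9⟩, h10⟩

/-- Direct sum of the two words. The diagonal factors keep their sup bounds; only the scalar bound
doubles, by a crude triangle inequality. -/
lemma HasFourFactorization.add {x y : Matrix (Fin n) (Fin n) A} {b M : ℝ}
    (hx : HasFourFactorization x b M) (hy : HasFourFactorization y b M) :
    HasFourFactorization (x + y) (b + b) M := by
  obtain ⟨P, i1, i2, β, γ, α₀, α₁, α₂, D₀, D₁, D₂, D₃, ⟨h1, h2, h3, h4, h5⟩, ⟨h6, h7, h8, h9⟩,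
    h10⟩ := hx
  obtain ⟨Q, i1', i2', β', γ', α₀', α₁', α₂', D₀', D₁', D₂', D₃', ⟨h1', h2', h3', h4', h5'⟩,
    ⟨h6', h7', h8', h9'⟩, h10'⟩ := hy
  refine ⟨P ⊕ Q, inferInstance, inferInstance, Matrix.fromCols β β', Matrix.fromRows γ γ',
    Matrix.fromBlocks α₀ 0 0 α₀', Matrix.fromBlocks α₁ 0 0 α₁', Matrix.fromBlocks α₂ 0 0 α₂',
    Sum.elim D₀ D₀', Sum.elim D₁ D₁', Sum.elim D₂ D₂', Sum.elim D₃ D₃',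
    ⟨(norm_fromCols_le _ _).trans (add_le_add h1 h1'),
      (norm_fromRows_le _ _).trans (add_le_add h2 h2'),
      (norm_fromBlocks_diag_le _ _).trans (add_le_add h3 h3'),
      (norm_fromBlocks_diag_le _ _).trans (add_le_add h4 h4'),
      (norm_fromBlocks_diag_le _ _).trans (add_le_add h5 h5')⟩,
    ⟨Sum.forall.2 ⟨h6, h6'⟩, Sum.forall.2 ⟨h7, h7'⟩, Sum.forall.2 ⟨h8, h8'⟩,
      Sum.forall.2 ⟨h9, h9'⟩⟩, fun i j => ?_⟩
  rw [Matrix.add_apply, h10, h10']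
  simp [Fintype.sum_sum_type]

lemma scalarMul_diagWord_three {N : ℕ} (β : Matrix (Fin n) (Fin N) ℂ)
    (γ : Matrix (Fin N) (Fin n) ℂ) (α : ℕ → Matrix (Fin N) (Fin N) ℂ) (D : ℕ → Fin N → A)
    (i j : Fin n) :
    scalarMul β (mulScalar (diagWord α D 3) γ) i j = ∑ p, ∑ s, ∑ r, ∑ q,
      (β i p * α 0 p q * α 1 q r * α 2 r s * γ s j) • (D 0 p * D 1 q * D 2 r * D 3 s) := by
  have h1 (p q) : diagWord α D 1 p q = α 0 p q • (D 0 p * D 1 q) := by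
    simp [diagWord, mulScalar, Matrix.mul_apply, Matrix.diagonal_apply, smul_mul_assoc]
  have hs (k p q) : diagWord α D (k + 1) p q =
      (∑ t, α k t q • diagWord α D k p t) * D (k + 1) q := by
    simp [diagWord, mulScalar, Matrix.mul_apply, Matrix.diagonal_apply]
  simp only [scalarMul, mulScalar, hs 2, hs 1, h1, Finset.sum_mul, Finset.smul_sum,
    smul_mul_assoc, smul_smul]
  refine Finset.sum_congr rfl fun p _ => Finset.sum_congr rfl fun s _ =>
    Finset.sum_congr rfl fun r _ => Finset.sum_congr rfl fun q _ => ?_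
  congr 1
  ring

/-- The exponent 5 counts the scalar matrices; only one diagonal factor contributes M. -/
lemma HasFourFactorization.exists_diagWord {x : Matrix (Fin n) (Fin n) A} {b M : ℝ}
    (h : HasFourFactorization x b M) (hb : 0 ≤ b) (hM : 0 ≤ M) :
    ∃ (N : ℕ) (β : Matrix (Fin n) (Fin N) ℂ) (γ : Matrix (Fin N) (Fin n) ℂ)
      (α : ℕ → Matrix (Fin N) (Fin N) ℂ) (D : ℕ → Fin N → A),
      x = scalarMul β (mulScalar (diagWord α D 3) γ) ∧
      (‖β‖ * (∏ i ∈ Finset.range 3, ‖α i‖) * ‖γ‖) *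
        (∏ i ∈ Finset.range (3 + 1), matNorm (Matrix.diagonal (D i))) ≤ b ^ 5 * M := by
  obtain ⟨P, i1, i2, β, γ, α₀, α₁, α₂, D₀, D₁, D₂, D₃, ⟨h1, h2, h3, h4, h5⟩, ⟨h6, h7, h8, h9⟩,
    h10⟩ := h
  let e := (Fintype.equivFin P).symm
  let α : ℕ → Matrix P P ℂ := fun k => if k = 0 then α₀ else if k = 1 then α₁ else α₂
  let D : ℕ → P → A :=
    fun k => if k = 0 then D₀ else if k = 1 then D₁ else if k = 2 then D₂ else D₃
  refine ⟨Fintype.card P, β.submatrix (Equiv.refl _) e, γ.submatrix e (Equiv.refl _),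
    fun k => (α k).submatrix e e, fun k p => D k (e p), ?_, ?_⟩
  · ext i j
    rw [scalarMul_diagWord_three, h10, ← e.sum_comp]
    refine Finset.sum_congr rfl fun p _ => ?_
    rw [← e.sum_comp]
    refine Finset.sum_congr rfl fun s _ => ?_
    rw [← e.sum_comp]
    refine Finset.sum_congr rfl fun r _ => ?_
    rw [← e.sum_comp]
    rfl
  · have hβ := (norm_submatrix_equiv_le β (Equiv.refl _) e).trans h1
    have hγ := (norm_submatrix_equiv_le γ e (Equiv.refl _)).trans h2
    have hα0 := (norm_submatrix_equiv_le α₀ e e).trans h3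
    have hα1 := (norm_submatrix_equiv_le α₁ e e).trans h4
    have hα2 := (norm_submatrix_equiv_le α₂ e e).trans h5
    have hD0 := matNorm_diagonal_le zero_le_one fun p => h6 (e p)
    have hD1 := matNorm_diagonal_le hM fun p => h7 (e p)
    have hD2 := matNorm_diagonal_le zero_le_one fun p => h8 (e p)
    have hD3 := matNorm_diagonal_le zero_le_one fun p => h9 (e p)
    simp only [Finset.prod_range_succ, Finset.prod_range_zero, one_mul]
    change ‖β.submatrix (Equiv.refl _) e‖ * (‖α₀.submatrix e e‖ * ‖α₁.submatrix e e‖ *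
      ‖α₂.submatrix e e‖) * ‖γ.submatrix e (Equiv.refl _)‖ *
      (matNorm (Matrix.diagonal fun p => D₀ (e p)) * matNorm (Matrix.diagonal fun p => D₁ (e p)) *
        matNorm (Matrix.diagonal fun p => D₂ (e p)) *
        matNorm (Matrix.diagonal fun p => D₃ (e p))) ≤ _
    calc _ ≤ b * (b * b * b) * b * (1 * M * 1 * 1) := by
          have k0 := matNorm_nonneg (Matrix.diagonal fun p => D₀ (e p))
          have k1 := matNorm_nonneg (Matrix.diagonal fun p => D₁ (e p))
          have k2 := matNorm_nonneg (Matrix.diagonal fun p => D₂ (e p))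
          have k3 := matNorm_nonneg (Matrix.diagonal fun p => D₃ (e p))
          gcongr
      _ = b ^ 5 * M := by ring

/-- It suffices to factor the nonzero matrices, with `‖D₁‖` at most a constant times the norm. -/
lemma hasLengthLE_four_of_factorization {b C : ℝ} (hb : 0 ≤ b) (hC : 0 ≤ C)
    (h : ∀ (n : ℕ) (x : Matrix (Fin n) (Fin n) A), x ≠ 0 →
      HasFourFactorization x b (C * matNorm x)) :
    HasLengthLE A 4 := by
  refine ⟨3, rfl, b ^ 5 * C, fun n x => ?_⟩
  by_cases hx : x = 0
  -- The zero matrix is the word of size N = 0.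
  · refine ⟨0, 0, 0, 0, 0, ?_, ?_⟩
    · ext i j
      simp [hx, scalarMul]
    · have := matNorm_nonneg x
      simp only [norm_zero, zero_mul]
      positivity
  · rw [mul_assoc]
    exact (h n x hx).exists_diagWord hb (mul_nonneg hC (matNorm_nonneg x))

end Factorization

end OpLength

/-! ### Weyl unitaries -/

namespace OpLength

section Weyl

/-- A family of unitary matrices that is an orthogonal basis of the matrix algebra. -/
structure IsUnitaryBasis {G Z : Type*} [Fintype G] [Fintype Z] [DecidableEq G] [DecidableEq Z]
    (W : G → Matrix Z Z ℂ) : Prop where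
  unitary : ∀ g s u, ∑ r, star (W g r s) * W g r u = if s = u then 1 else 0
  complete : ∀ r s t u, ∑ g, star (W g r s) * W g t u =
    if r = t ∧ s = u then (Fintype.card Z : ℂ) else 0
  orthogonal : ∀ g h, ∑ r, ∑ s, star (W g r s) * W h r s =
    if g = h then (Fintype.card Z : ℂ) else 0

/-- The Weyl unitaries `e_s ↦ ω^{bs} e_{s+a}`. -/
noncomputable def weyl {n : ℕ} [NeZero n] (g : ZMod n × ZMod n) : Matrix (ZMod n) (ZMod n) ℂ :=
  fun r s => if r = s + g.1 then ZMod.stdAddChar (g.2 * s) else 0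

lemma sum_stdAddChar_mul {n : ℕ} [NeZero n] (a : ZMod n) :
    ∑ b : ZMod n, (ZMod.stdAddChar (b * a) : ℂ) = if a = 0 then (n : ℂ) else 0 := by
  rw [AddChar.sum_mulShift a (ZMod.isPrimitive_stdAddChar n), ZMod.card]
  push_cast
  rfl

lemma star_weyl_mul {n : ℕ} [NeZero n] (g h : ZMod n × ZMod n) (r s t u : ZMod n) :
    star (weyl g r s) * weyl h t u =
      if r = s + g.1 ∧ t = u + h.1 then (ZMod.stdAddChar (h.2 * u - g.2 * s) : ℂ) else 0 := by
  unfold weyl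
  by_cases h1 : r = s + g.1 <;> by_cases h2 : t = u + h.1 <;> simp [h1, h2]
  rw [← AddChar.map_neg_eq_conj, ← AddChar.map_add_eq_mul]
  congr 1
  ring

/-- Orthogonality of the characters of ℤ/n: summing over the phase b forces equal columns in
`complete`, and summing over s forces equal phases in `orthogonal`. The shifts are compared
directly. -/
lemma isUnitaryBasis_weyl {n : ℕ} [NeZero n] :
    IsUnitaryBasis (weyl : ZMod n × ZMod n → Matrix (ZMod n) (ZMod n) ℂ) where
  unitary g s u := by
    simp only [star_weyl_mul]
    by_cases h : s = u
    · subst h; simp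
    · rw [if_neg h]
      refine Finset.sum_eq_zero fun r _ => if_neg fun hr => h ?_
      exact add_right_cancel (hr.1.symm.trans hr.2)
  complete r s t u := by
    simp only [star_weyl_mul, Fintype.sum_prod_type, ZMod.card]
    have h1 (a : ZMod n) : (∑ b : ZMod n, if r = s + a ∧ t = u + a then
        (ZMod.stdAddChar (b * u - b * s) : ℂ) else 0) =
        if r - s = a then (if t - u = a then (if u - s = 0 then (n : ℂ) else 0) else 0) else 0 := by
      simp only [← mul_sub, sub_eq_iff_eq_add']
      by_cases hr : r = s + a <;> by_cases ht : t = u + a <;> simp [hr, ht, sum_stdAddChar_mul]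
      simp [sub_eq_zero]
    simp only [h1, Finset.sum_ite_eq, Finset.mem_univ, if_true, sub_eq_zero]
    by_cases hs : u = s
    · subst hs; simp [eq_comm]
    · simp [hs, Ne.symm hs]
  orthogonal g h := by
    simp only [star_weyl_mul, ZMod.card]
    rw [Finset.sum_comm]
    have h1 (s : ZMod n) : (∑ r : ZMod n, if r = s + g.1 ∧ r = s + h.1 then
        (ZMod.stdAddChar (h.2 * s - g.2 * s) : ℂ) else 0) =
        if g.1 = h.1 then ZMod.stdAddChar (s * (h.2 - g.2)) else 0 := by
      have h2 : h.2 * s - g.2 * s = s * (h.2 - g.2) := by ring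
      by_cases hg : g.1 = h.1
      · simp [hg, h2]
      · rw [if_neg hg]
        refine Finset.sum_eq_zero fun r _ => if_neg fun hr => hg ?_
        exact add_left_cancel (hr.1.symm.trans hr.2)
    simp only [h1]
    by_cases hg : g.1 = h.1
    · simp [hg, sum_stdAddChar_mul, Prod.ext_iff, sub_eq_zero, eq_comm]
    · simp [hg, Prod.ext_iff]

lemma exists_isUnitaryBasis (n : ℕ) [NeZero n] :
    ∃ (G : Type) (_ : Fintype G) (_ : DecidableEq G) (W : G → Matrix (Fin n) (Fin n) ℂ),
      Fintype.card G = n ^ 2 ∧ IsUnitaryBasis W := by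
  let e : Fin n ≃ ZMod n := Fintype.equivOfCardEq (by simp)
  have hw := isUnitaryBasis_weyl (n := n)
  refine ⟨ZMod n × ZMod n, inferInstance, inferInstance, fun g => (weyl g).submatrix e e,
    by simp [sq], ⟨fun g s u => ?_, fun r s t u => ?_, fun g h => ?_⟩⟩
  · have := hw.unitary g (e s) (e u)
    rw [← e.sum_comp] at this
    simpa using this
  · simpa using hw.complete (e r) (e s) (e t) (e u)
  · have := hw.orthogonal g h
    rw [← e.sum_comp] at this
    simp_rw [← e.sum_comp (fun s => star (weyl g _ s) * weyl h _ s)] at this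
    simpa using this

end Weyl

end OpLength

/-! ### Matrices that commute with many matrix units -/

namespace OpLength

/-- A system of `n × n` matrix units `e i j` together with contractions `a₀`, `a₁` that are
supported by the projection `∑ i, e i i` and satisfy `a₀⋆ a₀ + a₁⋆ a₁ = 1`. -/
structure MatrixUnitCover (n : ℕ) (A : Type*) [NonUnitalNormedRing A] [StarRing A] where
  e : Fin n → Fin n → A
  a₀ : A
  a₁ : A
  e_mul : ∀ i j k l, e i j * e k l = if j = k then e i l else 0
  star_e : ∀ i j, star (e i j) = e j i
  support_a₀ : (∑ i, e i i) * a₀ = a₀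
  support_a₁ : (∑ i, e i i) * a₁ = a₁
  norm_a₀ : ‖a₀‖ ≤ 1
  norm_a₁ : ‖a₁‖ ≤ 1
  unit : ∀ x, (star a₀ * a₀ + star a₁ * a₁) * x = x

namespace MatrixUnitCover

/-- `x` commutes with the matrix units and with the two contractions. -/
def Commutes {n : ℕ} {A : Type*} [NonUnitalNormedRing A] [StarRing A] (c : MatrixUnitCover n A)
    (x : A) : Prop :=
  (∀ i j, Commute x (c.e i j)) ∧ Commute x c.a₀ ∧ Commute x c.a₁

variable {n : ℕ} {A : Type*} [NonUnitalCStarAlgebra A] (c : MatrixUnitCover n A)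

/-- The copy of a scalar matrix spanned by the matrix units. -/
def copy (W : Matrix (Fin n) (Fin n) ℂ) : A := ∑ r, ∑ s, W r s • c.e r s

lemma star_copy_mul_copy {W : Matrix (Fin n) (Fin n) ℂ}
    (hW : ∀ s u, ∑ r, star (W r s) * W r u = if s = u then 1 else 0) :
    star (c.copy W) * c.copy W = ∑ i, c.e i i := by
  simp only [copy, star_sum, star_smul, c.star_e, Finset.sum_mul, Finset.mul_sum,
    smul_mul_smul_comm, c.e_mul, smul_ite, smul_zero]
  calc _ = ∑ u, ∑ s, ∑ r, (star (W r s) * W r u) • c.e s u := by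
        rw [Finset.sum_comm]
        refine Finset.sum_congr rfl fun u _ => ?_
        rw [Finset.sum_comm (s := Finset.univ (α := Fin n)) (t := Finset.univ (α := Fin n))
          (f := fun s r => (star (W r s) * W r u) • c.e s u)]
        refine Finset.sum_congr rfl fun t _ => ?_
        rw [Finset.sum_comm]
        simp
    _ = _ := by simp only [← Finset.sum_smul, hW, ite_smul]; simp

lemma sum_e_idem : (∑ i, c.e i i) * ∑ i, c.e i i = ∑ i, c.e i i := by
  simp [Finset.sum_mul, Finset.mul_sum, c.e_mul]

lemma norm_copy_le {W : Matrix (Fin n) (Fin n) ℂ}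
    (hW : ∀ s u, ∑ r, star (W r s) * W r u = if s = u then 1 else 0) : ‖c.copy W‖ ≤ 1 :=
  norm_le_one_of_star_mul_self <| by rw [star_copy_mul_copy c hW, sum_e_idem]

lemma norm_e_le (i j : Fin n) : ‖c.e i j‖ ≤ 1 :=
  norm_le_one_of_star_mul_self <| by simp [c.star_e, c.e_mul]

/-! ### Matrix units as contractive combinations of products of two unitaries. -/

section Flip

variable {G : Type} [Fintype G] [DecidableEq G] {W : G → Matrix (Fin n) (Fin n) ℂ}

lemma sum_star_smul_copy (hW : IsUnitaryBasis W) (r s : Fin n) :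
    ∑ g, star (W g r s) • c.copy (W g) = (n : ℂ) • c.e r s := by
  simp only [copy, Finset.smul_sum, smul_smul]
  rw [Finset.sum_comm]
  simp_rw [Finset.sum_comm (s := Finset.univ (α := G)), ← Finset.sum_smul, hW.complete]
  simp [ite_and, ite_smul]

/-- The scalar unitary matrix in the factorization of the flip. -/
noncomputable def flipMatrix (W : G → Matrix (Fin n) (Fin n) ℂ) : Matrix (G × Fin n) (G × Fin n) ℂ :=
  fun p q => (n : ℂ)⁻¹ * ∑ l, star (W q.1 l p.2) * star (W p.1 q.2 l)

/-- The entry at (g,i), (h,k) is n⁻¹ times the conjugate of (W_g W_h)_{ki}. The rows are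
orthonormal: completeness removes the sum over h, and orthogonality of W_g and W_{g'} does the rest.
-/
lemma norm_flipMatrix_le [NeZero n] (hW : IsUnitaryBasis W) : ‖flipMatrix W‖ ≤ 1 := by
  have hn : (n : ℂ) ≠ 0 := NeZero.ne _
  apply norm_le_one_of_mul_conjTranspose
  ext ⟨g, i⟩ ⟨g', i'⟩
  rw [Matrix.mul_apply, Fintype.sum_prod_type, Matrix.one_apply]
  simp only [Matrix.conjTranspose_apply, flipMatrix, star_mul', star_sum, star_star, star_inv₀,
    star_natCast]
  have key (h : G) (k : Fin n) :
      (n : ℂ)⁻¹ * (∑ l, star (W h l i) * star (W g k l)) *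
        ((n : ℂ)⁻¹ * ∑ l, W h l i' * W g' k l) =
      (n : ℂ)⁻¹ ^ 2 * ∑ l, ∑ l', (star (W h l i) * W h l' i') * (star (W g k l) * W g' k l') := by
    rw [mul_mul_mul_comm, Finset.sum_mul_sum, sq]
    congr 1
    refine Finset.sum_congr rfl fun l _ => Finset.sum_congr rfl fun l' _ => ?_
    ring
  simp only [key, ← Finset.mul_sum]
  rw [Finset.sum_comm]
  simp_rw [Finset.sum_comm (s := Finset.univ (α := G)), ← Finset.sum_mul, hW.complete]
  have h2 := hW.orthogonal g g'
  by_cases hi : i = i'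
  · simp only [hi, and_true, ite_mul, zero_mul, Finset.sum_ite_eq, Finset.mem_univ, if_true,
      ← Finset.mul_sum, h2, Fintype.card_fin]
    by_cases hg : g = g'
    · simp only [hg, if_true]
      field_simp
    · simp [hg]
  · simp [hi]

/-- Write n³ e_{ki} = ∑_l (n e_{kl})(n e_{li}) and expand both factors in the unitary basis. -/
lemma e_eq_sum_flipMatrix [NeZero n] (hW : IsUnitaryBasis W) (k i : Fin n) :
    c.e k i = ∑ g, ∑ h, ((n : ℂ)⁻¹ ^ 2 * flipMatrix W (g, i) (h, k)) •
      (c.copy (W g) * c.copy (W h)) := by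
  have hn : (n : ℂ) ≠ 0 := NeZero.ne _
  have h1 : (n : ℂ) ^ 3 • c.e k i = ∑ l, (∑ g, star (W g k l) • c.copy (W g)) *
      ∑ h, star (W h l i) • c.copy (W h) := by
    simp only [sum_star_smul_copy c hW, smul_mul_smul_comm, c.e_mul, if_true, Finset.sum_const,
      Finset.card_univ, Fintype.card_fin, ← Nat.cast_smul_eq_nsmul ℂ, smul_smul]
    congr 1
    ring
  have h2 : c.e k i = (n : ℂ)⁻¹ ^ 3 • (n : ℂ) ^ 3 • c.e k i := by
    rw [smul_smul, ← mul_pow, inv_mul_cancel₀ hn, one_pow, one_smul]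
  rw [h2, h1]
  simp only [Finset.sum_mul_sum, smul_mul_smul_comm]
  rw [Finset.sum_comm, Finset.smul_sum]
  refine Finset.sum_congr rfl fun g _ => ?_
  rw [Finset.sum_comm, Finset.smul_sum]
  refine Finset.sum_congr rfl fun h _ => ?_
  rw [← Finset.sum_smul, smul_smul]
  congr 1
  simp only [flipMatrix, ← mul_assoc, mul_comm (star (W h _ _))]
  ring

end Flip

/-- Expanding e_{ki} and e_{jk} gives the word a⋆W_g · W_h X · W_{h'} · W_{g'}a, whose four pieces
are the diagonal entries. -/
lemma hasFourFactorization_sandwich [NeZero n] {X a : A} {M : ℝ} (ha : ‖a‖ ≤ 1) (hX : ‖X‖ ≤ M) :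
    HasFourFactorization (fun i j => ∑ k, star a * c.e k i * X * (c.e j k * a)) 1 M := by
  obtain ⟨G, i1, i2, W, hG, hW⟩ := exists_isUnitaryBasis n
  have hn : (n : ℂ) ≠ 0 := NeZero.ne _
  have hG' : (Fintype.card G : ℂ) = (n : ℂ) ^ 2 := by rw [hG]; push_cast; rfl
  have hw (g : G) : ‖c.copy (W g)‖ ≤ 1 := c.norm_copy_le (hW.unitary g)
  -- As |G| = n², the weight n⁻¹ makes β a coisometry and n⁻² makes α₁ a projection: α₁ keeps k and
  -- averages freely over h and h'. The total n⁻¹ n⁻² n⁻¹ matches the two factors n⁻² of the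
  -- expansions.
  let β : Matrix (Fin n) (G × Fin n) ℂ :=
    .of fun i p => if i = p.2 then (n : ℂ)⁻¹ else 0
  let α₁ : Matrix (G × Fin n) (G × Fin n) ℂ :=
    .of fun p q => if p.2 = q.2 then (n : ℂ)⁻¹ ^ 2 else 0
  have hβ : ‖β‖ ≤ 1 := by
    apply norm_le_one_of_mul_conjTranspose
    ext i j
    rw [Matrix.mul_apply, Fintype.sum_prod_type, Matrix.one_apply]
    by_cases h : i = j
    · simp [β, h, hG']; field_simp
    · simp [β, h, Ne.symm h]
  have hα₁ : ‖α₁‖ ≤ 1 := by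
    apply norm_le_one_of_isIdempotent
    · ext p q
      simp [α₁, Matrix.star_apply, eq_comm, apply_ite (starRingEnd ℂ)]
    · ext p q
      rw [Matrix.mul_apply, Fintype.sum_prod_type]
      by_cases h : p.2 = q.2
      · simp [α₁, h, hG']; field_simp
      · simp [α₁, h]
  refine ⟨G × Fin n, inferInstance, inferInstance, β, β.conjTranspose, flipMatrix W, α₁,
    flipMatrix W, fun p => star a * c.copy (W p.1), fun p => c.copy (W p.1) * X,
    fun p => c.copy (W p.1), fun p => c.copy (W p.1) * a,
    ⟨hβ, norm_conjTranspose_le hβ, norm_flipMatrix_le hW, hα₁, norm_flipMatrix_le hW⟩,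
    ⟨fun p => ?_, fun p => ?_, fun p => hw p.1, fun p => ?_⟩, fun i j => ?_⟩
  · exact (norm_mul_le _ _).trans (mul_le_one₀ (by rwa [norm_star]) (norm_nonneg _) (hw _))
  · exact (norm_mul_le _ _).trans ((mul_le_of_le_one_left (norm_nonneg _) (hw _)).trans hX)
  · exact (norm_mul_le _ _).trans (mul_le_one₀ (hw _) (norm_nonneg _) ha)
  · let T (g h h' g' : G) (k : Fin n) : A :=
      ((n : ℂ)⁻¹ ^ 2 * flipMatrix W (g, i) (h, k) *
        ((n : ℂ)⁻¹ ^ 2 * flipMatrix W (h', k) (g', j))) •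
        (star a * c.copy (W g) * (c.copy (W h) * X) * c.copy (W h') * (c.copy (W g') * a))
    have hl (k : Fin n) : star a * c.e k i * X * (c.e j k * a) =
        ∑ g, ∑ h, ∑ h', ∑ g', T g h h' g' k := by
      conv_lhs => rw [c.e_eq_sum_flipMatrix hW k i, c.e_eq_sum_flipMatrix hW j k]
      simp only [Finset.mul_sum, Finset.sum_mul, mul_smul_comm, smul_mul_assoc, Finset.smul_sum,
        smul_smul, T]
      calc _ = ∑ h', ∑ g', ∑ g, ∑ h, T g h h' g' k := by
            refine Finset.sum_congr rfl fun h' _ => Finset.sum_congr rfl fun g' _ =>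
              Finset.sum_congr rfl fun g _ => Finset.sum_congr rfl fun h _ => ?_
            simp only [T, mul_assoc]
            congr 1
            ring
        _ = ∑ g, ∑ h', ∑ g', ∑ h, T g h h' g' k := by
            rw [Finset.sum_congr rfl fun h' _ => Finset.sum_comm]
            rw [Finset.sum_comm]
        _ = ∑ g, ∑ h', ∑ h, ∑ g', T g h h' g' k :=
            Finset.sum_congr rfl fun g _ => Finset.sum_congr rfl fun h' _ => Finset.sum_comm
        _ = ∑ g, ∑ h, ∑ h', ∑ g', T g h h' g' k :=
            Finset.sum_congr rfl fun g _ => Finset.sum_comm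
    -- This is the order of the sums over p, s, r, q once the Kronecker deltas in β, its adjoint and
    -- α₁ are collapsed.
    calc ∑ k, star a * c.e k i * X * (c.e j k * a) = ∑ g, ∑ g', ∑ h', ∑ k, ∑ h, T g h h' g' k := by
          simp only [hl]
          rw [Finset.sum_comm]
          refine Finset.sum_congr rfl fun g _ => ?_
          calc _ = ∑ k, ∑ g', ∑ h', ∑ h, T g h h' g' k := by
                refine Finset.sum_congr rfl fun k _ => ?_
                rw [Finset.sum_comm, Finset.sum_congr rfl fun h' _ => Finset.sum_comm,
                  Finset.sum_comm]
            _ = ∑ g', ∑ k, ∑ h', ∑ h, T g h h' g' k := Finset.sum_comm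
            _ = _ := Finset.sum_congr rfl fun g' _ => Finset.sum_comm
      _ = _ := by
          simp only [Fintype.sum_prod_type, β, α₁, Matrix.conjTranspose_apply]
          simp [apply_ite (starRingEnd ℂ), mul_ite, ite_mul, ite_smul]
          refine Finset.sum_congr rfl fun g _ => Finset.sum_congr rfl fun g' _ =>
            Finset.sum_congr rfl fun h' _ => Finset.sum_congr rfl fun k _ =>
            Finset.sum_congr rfl fun h _ => ?_
          simp only [T]
          congr 1
          ring

/-! ### Recovering a commuting matrix from its compression. -/

section Commuting

variable {c}

/-- Multiplying X by e_{ki} and e_{jk} isolates e_{k0} y_{ij} e_{0k} = e_{kk} y_{ij}; summing over k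
gives p y_{ij}, and p a = a removes p. -/
lemma sum_mul_eq [NeZero n] {y : Matrix (Fin n) (Fin n) A} (hy : ∀ i j, c.Commutes (y i j))
    {a : A} (ha : (∑ i, c.e i i) * a = a) (hya : ∀ i j, Commute (y i j) a) (i j : Fin n) :
    ∑ k, star a * c.e k i * (∑ r, ∑ s, c.e r 0 * y r s * c.e 0 s) * (c.e j k * a) =
      star a * a * y i j := by
  have h1 (k : Fin n) : star a * c.e k i * (∑ r, ∑ s, c.e r 0 * y r s * c.e 0 s) *
      (c.e j k * a) = star a * (c.e k k * a) * y i j := by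
    have h2 : c.e k i * (∑ r, ∑ s, c.e r 0 * y r s * c.e 0 s) * c.e j k = c.e k k * y i j := by
      simp only [Finset.mul_sum, Finset.sum_mul, ← mul_assoc, c.e_mul, ite_mul, zero_mul]
      simp only [mul_assoc, c.e_mul, mul_ite, mul_zero]
      simp only [Finset.sum_ite_irrel, Finset.sum_const_zero, Finset.sum_ite_eq, Finset.sum_ite_eq',
        Finset.mem_univ, if_true]
      rw [((hy i j).1 0 k).eq, ← mul_assoc, c.e_mul, if_pos rfl]
    calc _ = star a * (c.e k i * (∑ r, ∑ s, c.e r 0 * y r s * c.e 0 s) * c.e j k) * a := by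
          simp only [mul_assoc]
      _ = star a * (c.e k k * (y i j * a)) := by rw [h2]; simp only [mul_assoc]
      _ = _ := by rw [(hya i j).eq]; simp only [mul_assoc]
  simp only [h1, ← Finset.sum_mul, ← Finset.mul_sum, ha]

lemma hasFourFactorization_of_commutes [NeZero n] {y : Matrix (Fin n) (Fin n) A}
    (hy : ∀ i j, c.Commutes (y i j)) :
    HasFourFactorization y 2 ‖∑ r, ∑ s, c.e r 0 * y r s * c.e 0 s‖ := by
  have h := (c.hasFourFactorization_sandwich c.norm_a₀ le_rfl).add
    (c.hasFourFactorization_sandwich (X := ∑ r, ∑ s, c.e r 0 * y r s * c.e 0 s) c.norm_a₁ le_rfl)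
  rw [one_add_one_eq_two] at h
  convert h using 1
  ext i j
  change y i j = ∑ k, star c.a₀ * c.e k i * (∑ r, ∑ s, c.e r 0 * y r s * c.e 0 s) *
    (c.e j k * c.a₀) + ∑ k, star c.a₁ * c.e k i * (∑ r, ∑ s, c.e r 0 * y r s * c.e 0 s) *
    (c.e j k * c.a₁)
  rw [sum_mul_eq hy c.support_a₀ (fun i j => (hy i j).2.1),
    sum_mul_eq hy c.support_a₁ (fun i j => (hy i j).2.2), ← add_mul, c.unit]

end Commuting

lemma norm_compression_le [NeZero n] (x : Matrix (Fin n) (Fin n) A) :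
    ‖∑ r, ∑ s, c.e r 0 * x r s * c.e 0 s‖ ≤ matNorm x := by
  let : PartialOrder A := CStarAlgebra.spectralOrder A
  have : StarOrderedRing A := CStarAlgebra.spectralOrderedRing A
  change _ ≤ ‖CStarMatrix.ofMatrix x‖
  -- The column (e_{0s})_s padded to a square matrix. R⋆R has the projection p as its only nonzero
  -- entry, and the compression is the corner entry of R⋆xR.
  let R : CStarMatrix (Fin n) (Fin n) A :=
    CStarMatrix.ofMatrix (.of fun s l => if l = 0 then c.e 0 s else 0)
  have hR : ‖R‖ ≤ 1 := by
    apply norm_le_one_of_star_mul_self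
    have h (k l : Fin n) : (star R * R) k l = if k = 0 ∧ l = 0 then ∑ i, c.e i i else 0 := by
      rw [CStarMatrix.mul_apply]
      by_cases hk : k = 0 <;> by_cases hl : l = 0 <;>
        simp [R, CStarMatrix.star_apply, hk, hl, c.star_e, c.e_mul]
    ext k l
    rw [CStarMatrix.mul_apply]
    simp only [h]
    by_cases hk : k = 0 <;> by_cases hl : l = 0 <;> simp [hk, hl, c.sum_e_idem]
  have h0 : (star R * CStarMatrix.ofMatrix x * R) 0 0 =
      ∑ r, ∑ s, c.e r 0 * x r s * c.e 0 s := by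
    rw [Finset.sum_comm]
    simp [CStarMatrix.mul_apply, R, CStarMatrix.star_apply, c.star_e, Finset.sum_mul]
  rw [← h0]
  calc _ ≤ ‖star R * CStarMatrix.ofMatrix x * R‖ := CStarMatrix.norm_entry_le_norm
    _ ≤ ‖star R‖ * ‖CStarMatrix.ofMatrix x‖ * ‖R‖ :=
      (norm_mul_le _ _).trans (mul_le_mul_of_nonneg_right (norm_mul_le _ _) (norm_nonneg _))
    _ ≤ 1 * ‖CStarMatrix.ofMatrix x‖ * 1 := by
      rw [norm_star]; gcongr
    _ = _ := by ring

end MatrixUnitCover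

/-! ### Approximation by commuting entries. -/

section Main

variable {A : Type*} [NonUnitalCStarAlgebra A]

/-- Put the entries n · x_{ij} on a diagonal indexed by pairs (i,j), between scalar matrices with
entries n^{-1/2}; the three other factors are the unit u. The loss of n is harmless for small
errors. -/
lemma hasFourFactorization_of_entries {n : ℕ} [NeZero n] {u : A} (hu : star u = u)
    (hul : ∀ x, u * x = x) (hur : ∀ x, x * u = x) (x : Matrix (Fin n) (Fin n) A) {M : ℝ}
    (h : ∀ i j, n * ‖x i j‖ ≤ M) : HasFourFactorization x 1 M := by
  have hu1 : ‖u‖ ≤ 1 := norm_le_one_of_isIdempotent hu (hul u)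
  have hn : (n : ℂ) ≠ 0 := NeZero.ne _
  have h1 : ‖(1 : Matrix (Fin n × Fin n) (Fin n × Fin n) ℂ)‖ ≤ 1 :=
    norm_le_one_of_isIdempotent (by simp) (by simp)
  have hs : ((√(n : ℝ) : ℝ) : ℂ) * ((√(n : ℝ) : ℝ) : ℂ) = n := by
    rw [← Complex.ofReal_mul, Real.mul_self_sqrt (by positivity)]; simp
  let β : Matrix (Fin n) (Fin n × Fin n) ℂ :=
    .of fun i p => if i = p.1 then ((√(n : ℝ) : ℝ) : ℂ)⁻¹ else 0
  let γ : Matrix (Fin n × Fin n) (Fin n) ℂ :=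
    .of fun p i => if i = p.2 then ((√(n : ℝ) : ℝ) : ℂ)⁻¹ else 0
  have hβ : ‖β‖ ≤ 1 := by
    apply norm_le_one_of_mul_conjTranspose
    ext i j
    rw [Matrix.mul_apply, Fintype.sum_prod_type, Matrix.one_apply]
    by_cases h : i = j
    · simp [β, h, ← mul_inv, hs, hn]
    · simp [β, h, Ne.symm h]
  have hγ : ‖γ‖ ≤ 1 := by
    rw [← Matrix.l2_opNorm_conjTranspose]
    apply norm_le_one_of_mul_conjTranspose
    ext i j
    rw [Matrix.mul_apply, Fintype.sum_prod_type, Matrix.one_apply]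
    by_cases h : i = j
    · simp [γ, h, ← mul_inv, hs, hn]
    · simp [γ, h]
  refine ⟨Fin n × Fin n, inferInstance, inferInstance, β, γ, 1, 1, 1, fun _ => u,
    fun p => (n : ℂ) • x p.1 p.2, fun _ => u, fun _ => u, ⟨hβ, hγ, h1, h1, h1⟩,
    ⟨fun _ => hu1, fun p => ?_, fun _ => hu1, fun _ => hu1⟩, fun i j => ?_⟩
  · rw [norm_smul]
    simpa using h p.1 p.2
  · simp only [hul, hur, Matrix.one_apply, Fintype.sum_prod_type, β, γ, Prod.mk.injEq]
    simp [ite_and, smul_smul, ← mul_inv, hs, hn]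

/-- If all finite families in `A` are close to families commuting with matrix units of any given
size (which cover the unit in two steps), then four diagonal factors suffice for `A`. -/
theorem hasLengthLE_four_of_matrixUnitCover
    (h : ∀ (n : ℕ) [NeZero n] (x : Matrix (Fin n) (Fin n) A) (δ : ℝ), 0 < δ →
      ∃ (y : Matrix (Fin n) (Fin n) A) (c : MatrixUnitCover n A),
        (∀ i j, ‖x i j - y i j‖ ≤ δ) ∧ ∀ i j, c.Commutes (y i j)) :
    HasLengthLE A 4 := by
  -- The value b = 4 is 2 for the commuting part plus 2 for the error; C = 2 since passing from x to
  -- y at most doubles the compression bound.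
  refine hasLengthLE_four_of_factorization (b := 4) (C := 2) (by norm_num) (by norm_num)
    fun n x hx => ?_
  have hn : NeZero n := ⟨by rintro rfl; exact hx (Subsingleton.elim _ _)⟩
  have hn1 : (1 : ℝ) ≤ n := by exact_mod_cast NeZero.one_le
  have hpos : 0 < matNorm x := by
    obtain ⟨i, j, hij⟩ : ∃ i j, x i j ≠ 0 := by
      by_contra! h0
      exact hx (by ext i j; exact h0 i j)
    refine (norm_pos_iff.2 hij).trans_le ?_
    let : PartialOrder A := CStarAlgebra.spectralOrder A
    have : StarOrderedRing A := CStarAlgebra.spectralOrderedRing A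
    exact CStarMatrix.norm_entry_le_norm (M := CStarMatrix.ofMatrix x)
  -- The tolerance ‖x‖/n² lets the n² error terms of the compression add up to at most ‖x‖.
  obtain ⟨y, c, hxy, hy⟩ := h n x (matNorm x / n ^ 2) (by positivity)
  have hyM : ‖∑ r, ∑ s, c.e r 0 * y r s * c.e 0 s‖ ≤ 2 * matNorm x := by
    have h1 : ∑ r, ∑ s, c.e r 0 * y r s * c.e 0 s = (∑ r, ∑ s, c.e r 0 * x r s * c.e 0 s) -
        ∑ r, ∑ s, c.e r 0 * (x r s - y r s) * c.e 0 s := by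
      simp only [mul_sub, sub_mul, Finset.sum_sub_distrib, sub_sub_cancel]
    have h2 : ‖∑ r, ∑ s, c.e r 0 * (x r s - y r s) * c.e 0 s‖ ≤ matNorm x := by
      calc _ ≤ ∑ r : Fin n, ∑ s : Fin n, matNorm x / n ^ 2 := by
            refine norm_sum_le_of_le _ fun r _ => norm_sum_le_of_le _ fun s _ => ?_
            calc _ ≤ ‖c.e r 0‖ * ‖x r s - y r s‖ * ‖c.e 0 s‖ := (norm_mul_le _ _).trans
                  (mul_le_mul_of_nonneg_right (norm_mul_le _ _) (norm_nonneg _))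
              _ ≤ 1 * (matNorm x / n ^ 2) * 1 := by
                  gcongr
                  exacts [c.norm_e_le _ _, hxy r s, c.norm_e_le _ _]
              _ = _ := by ring
        _ = matNorm x := by
            simp only [Finset.sum_const, Finset.card_univ, Fintype.card_fin, nsmul_eq_mul]
            field_simp
    rw [h1]
    linarith [norm_sub_le (∑ r, ∑ s, c.e r 0 * x r s * c.e 0 s)
      (∑ r, ∑ s, c.e r 0 * (x r s - y r s) * c.e 0 s), c.norm_compression_le x]
  have hu : star (star c.a₀ * c.a₀ + star c.a₁ * c.a₁) = star c.a₀ * c.a₀ + star c.a₁ * c.a₁ := by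
    simp
  have hz := hasFourFactorization_of_entries hu c.unit (fun z => by
      have := congrArg star (c.unit (star z))
      rwa [star_mul, hu, star_star] at this) (x - y) (M := 2 * matNorm x) (fun i j => by
    calc (n : ℝ) * ‖(x - y) i j‖ ≤ n * (matNorm x / n ^ 2) := by
          gcongr; exact hxy i j
      _ = matNorm x / n := by field_simp
      _ ≤ matNorm x := div_le_self hpos.le hn1
      _ ≤ 2 * matNorm x := by linarith)
  have hfin := ((MatrixUnitCover.hasFourFactorization_of_commutes hy).mono le_rfl hyM).add
    (hz.mono one_le_two le_rfl)
  rw [add_sub_cancel] at hfin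
  exact hfin.mono (by norm_num) le_rfl

end Main

end OpLength

/-! ### From matrix units to covers, and bounded families -/

namespace OpLength

/-- A system of matrix units summing up to `1`. -/
structure IsMatrixUnits {R S : Type*} [Ring R] [StarRing R] [Fintype S] [DecidableEq S]
    (ε : S → S → R) : Prop where
  mul_eq : ∀ i j k l, ε i j * ε k l = if j = k then ε i l else 0
  star_eq : ∀ i j, star (ε i j) = ε j i
  sum_eq : ∑ i, ε i i = 1

section Cover

variable {R : Type*} [CStarAlgebra R] {S : Type*} [Fintype S] [DecidableEq S] {ε : S → S → R}

/-- Take q = ⌊|S|/n⌋ disjoint blocks of n indices, and let e_{ij} be the sum of the corresponding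
units over the blocks. The blocks fill at least half of S, so two partial isometries into them cover
the unit. -/
lemma IsMatrixUnits.exists_cover (hε : IsMatrixUnits ε) {n : ℕ} [NeZero n]
    (hn : n ≤ Fintype.card S) :
    ∃ c : MatrixUnitCover n R, ∀ b, (∀ s t, Commute b (ε s t)) → c.Commutes b := by
  set q := Fintype.card S / n with hq
  have hq1 : 1 ≤ q := (Nat.one_le_div_iff (NeZero.pos n)).2 hn
  have hle : q * n ≤ Fintype.card S := Nat.div_mul_le_self _ _
  have hlt : Fintype.card S < (q + 1) * n := by
    rw [mul_comm]; exact Nat.lt_mul_div_succ _ (NeZero.pos n)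
  obtain ⟨J⟩ : Nonempty (Fin q × Fin n ↪ S) :=
    Function.Embedding.nonempty_of_card_le (by simpa using hle)
  -- Here |S| < (q + 1)n ≤ 2qn because q ≥ 1. The Boolean tells which of the two partial isometries
  -- moves the index.
  obtain ⟨V⟩ : Nonempty (S ↪ Bool × (Fin q × Fin n)) := by
    apply Function.Embedding.nonempty_of_card_le
    simp only [Fintype.card_prod, Fintype.card_bool, Fintype.card_fin]
    nlinarith [NeZero.pos n]
  let a (d : Bool) : R := ∑ s, if (V s).1 = d then ε (J (V s).2) s else 0
  let e (i j : Fin n) : R := ∑ b, ε (J (b, i)) (J (b, j))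
  have ha (d : Bool) : star (a d) * a d = ∑ s, if (V s).1 = d then ε s s else 0 := by
    simp only [a, star_sum, Finset.sum_mul_sum]
    refine Finset.sum_congr rfl fun s _ => ?_
    have h (t : S) : star (if (V s).1 = d then ε (J (V s).2) s else 0) *
        (if (V t).1 = d then ε (J (V t).2) t else 0) =
        if s = t then (if (V s).1 = d then ε s s else 0) else 0 := by
      by_cases hst : s = t
      · subst hst
        by_cases hs : (V s).1 = d <;> simp [hs, hε.star_eq, hε.mul_eq]
      · by_cases hs : (V s).1 = d <;> by_cases ht : (V t).1 = d <;>
          simp [hs, ht, hε.star_eq, hε.mul_eq, hst]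
        intro h2
        exact absurd (V.injective (Prod.ext (hs.trans ht.symm) h2)) hst
    simp only [h, Finset.sum_ite_eq, Finset.mem_univ, if_true]
  have hnorm (d : Bool) : ‖a d‖ ≤ 1 := by
    apply norm_le_one_of_star_mul_self
    simp only [ha, Finset.sum_mul_sum, ite_mul, mul_ite, zero_mul, mul_zero, hε.mul_eq]
    refine Finset.sum_congr rfl fun s _ => ?_
    by_cases hs : (V s).1 = d
    · simp only [hs, if_true]
      rw [Finset.sum_eq_single s]
      · simp [hs]
      · intro t _ hts
        simp [Ne.symm hts]
      · simp
    · simp [hs]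
  have hsupp (d : Bool) : (∑ i, e i i) * a d = a d := by
    simp only [a, e, Finset.mul_sum, Finset.sum_mul]
    refine Finset.sum_congr rfl fun s _ => ?_
    by_cases hs : (V s).1 = d
    · simp only [hs, if_true, hε.mul_eq, J.injective.eq_iff]
      rw [Finset.sum_comm, ← Fintype.sum_prod_type' (f := fun b i =>
        if (b, i) = (V s).2 then ε (J (b, i)) s else 0)]
      simp
    · simp [hs]
  refine ⟨⟨e, a false, a true, fun i j k l => ?_, fun i j => ?_, hsupp _, hsupp _, hnorm _,
    hnorm _, fun x => ?_⟩, fun b hb => ⟨fun i j => ?_, ?_, ?_⟩⟩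
  · simp only [e, Finset.sum_mul_sum, hε.mul_eq, J.injective.eq_iff, Prod.mk.injEq]
    by_cases h : j = k <;> simp [h]
  · simp [e, hε.star_eq]
  · have h : star (a false) * a false + star (a true) * a true = 1 := by
      rw [ha, ha, ← Finset.sum_add_distrib, ← hε.sum_eq]
      refine Finset.sum_congr rfl fun s _ => ?_
      cases (V s).1 <;> simp
    rw [h, one_mul]
  · change Commute b (∑ d, ε (J (d, i)) (J (d, j)))
    exact Commute.sum_right _ _ _ fun d _ => hb _ _
  · refine Commute.sum_right _ _ _ fun s _ => ?_
    split_ifs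
    exacts [hb _ _, Commute.zero_right _]
  · refine Commute.sum_right _ _ _ fun s _ => ?_
    split_ifs
    exacts [hb _ _, Commute.zero_right _]

end Cover

/-! ### Coordinatewise covers in ℓ_∞(I, C). -/

section Families

variable {I C : Type*} [CStarAlgebra C]

/-- A family bounded by a common constant, as an element of `ℓ_∞(I, C)`. -/
def boundedFamily (f : I → C) (b : ℝ) (h : ∀ t, ‖f t‖ ≤ b) : BddFamilies I C :=
  ⟨f, memℓp_infty ⟨b, by rintro _ ⟨t, rfl⟩; exact h t⟩⟩

lemma sum_boundedFamily_apply {ι : Type*} (s : Finset ι) (f : ι → I → C) {b : ℝ}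
    (h : ∀ i t, ‖f i t‖ ≤ b) (t : I) :
    (∑ i ∈ s, boundedFamily (f i) b (h i)) t = ∑ i ∈ s, f i t := by
  rw [lp.coeFn_sum, Finset.sum_apply]
  rfl

/-- The cover of `ℓ_∞(I, C)` given by a family of covers of `C`. -/
def MatrixUnitCover.family {n : ℕ} (c : I → MatrixUnitCover n C) :
    MatrixUnitCover n (BddFamilies I C) where
  e i j := boundedFamily (fun t => (c t).e i j) 1 fun t => (c t).norm_e_le i j
  a₀ := boundedFamily (fun t => (c t).a₀) 1 fun t => (c t).norm_a₀
  a₁ := boundedFamily (fun t => (c t).a₁) 1 fun t => (c t).norm_a₁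
  e_mul i j k l := by
    ext t
    refine ((c t).e_mul i j k l).trans ?_
    by_cases h : j = k
    · simp only [h, if_true]; rfl
    · simp only [h, if_false]; rfl
  star_e i j := by
    ext t
    exact (c t).star_e i j
  support_a₀ := by
    ext t
    exact (congrArg (· * (c t).a₀) (sum_boundedFamily_apply _ _ _ t)).trans (c t).support_a₀
  support_a₁ := by
    ext t
    exact (congrArg (· * (c t).a₁) (sum_boundedFamily_apply _ _ _ t)).trans (c t).support_a₁
  norm_a₀ := lp.norm_le_of_forall_le zero_le_one fun t => (c t).norm_a₀
  norm_a₁ := lp.norm_le_of_forall_le zero_le_one fun t => (c t).norm_a₁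
  unit x := by
    ext t
    exact (c t).unit (x t)

/-- The approximants and covers may vary arbitrarily with the coordinate: the tolerance δ and the
norm bounds of the covers are uniform, so they assemble into bounded families. -/
theorem hasLengthLE_four_bddFamilies
    (h : ∀ (n : ℕ) [NeZero n] (x : Matrix (Fin n) (Fin n) C) (δ : ℝ), 0 < δ →
      ∃ (y : Matrix (Fin n) (Fin n) C) (c : MatrixUnitCover n C),
        (∀ i j, ‖x i j - y i j‖ ≤ δ) ∧ ∀ i j, c.Commutes (y i j)) :
    HasLengthLE (BddFamilies I C) 4 := by
  refine hasLengthLE_four_of_matrixUnitCover fun n _ x δ hδ => ?_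
  choose y c hxy hy using fun t : I => h n (fun i j => x i j t) δ hδ
  have hb (i j) (t : I) : ‖y t i j‖ ≤ ‖x i j‖ + δ := by
    have h1 := hxy t i j
    have h2 : ‖x i j t‖ ≤ ‖x i j‖ := lp.norm_apply_le_norm ENNReal.top_ne_zero _ t
    have h3 := norm_le_norm_add_norm_sub' (y t i j) (x i j t)
    rw [norm_sub_rev] at h3
    linarith
  refine ⟨fun i j => boundedFamily (fun t => y t i j) _ (hb i j), MatrixUnitCover.family c,
    fun i j => ?_, fun i j => ⟨fun k l => ?_, ?_, ?_⟩⟩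
  · exact lp.norm_le_of_forall_le hδ.le fun t => hxy t i j
  · ext t
    exact ((hy t i j).1 k l).eq
  · ext t
    exact (hy t i j).2.1.eq
  · ext t
    exact (hy t i j).2.2.eq

end Families

end OpLength

/-! ### Matrix units in infinite tensor products -/

namespace InfTensor

open OpLength

section Support

variable {J : Type*} [DecidableEq J] {n : J → ℕ} [∀ j, NeZero (n j)]

lemma commute_unitOp {j k : J} (h : j ≠ k) (r s : Fin (n j)) (t u : Fin (n k)) :
    Commute (unitOp j r s) (unitOp k t u) := by
  ext ξ f
  rw [mul_apply_eq_comp, mul_apply_eq_comp, unitOp_apply, unitOp_apply, unitOp_apply, unitOp_apply]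
  have h1 : (f.update j s) k = f k := by simp [Function.update_of_ne h.symm]
  have h2 : (f.update k u) j = f j := by simp [Function.update_of_ne h]
  have h3 : (f.update j s).update k u = (f.update k u).update j s := by
    ext i : 2
    simp [Function.update_comm h]
  rw [h1, h2, h3]
  split_ifs <;> rfl

lemma siteRep_apply (j : J) (a : Matrix (Fin (n j)) (Fin (n j)) ℂ) :
    siteRep n j a = ∑ r, ∑ s, a r s • unitOp j r s := rfl

lemma siteRep_single (j : J) (r s : Fin (n j)) :
    siteRep n j (Matrix.single r s 1) = unitOp j r s := by
  rw [siteRep_apply]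
  simp [Matrix.single_apply, ite_and, ite_smul]

variable (n) in
/-- The algebraic tensor product. -/
noncomputable abbrev finiteSupport : StarSubalgebra ℂ (Space n →L[ℂ] Space n) :=
  StarAlgebra.adjoin ℂ (⋃ j, Set.range (siteRep n j))

lemma unitOp_mem (j : J) (r s : Fin (n j)) : unitOp j r s ∈ finiteSupport n := by
  rw [← siteRep_single]
  exact StarAlgebra.subset_adjoin ℂ _ (Set.mem_iUnion.2 ⟨j, Set.mem_range_self _⟩)

/-- `b` commutes with all the sites outside `F`. -/
def SupportedOn (F : Finset J) (b : Space n →L[ℂ] Space n) : Prop :=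
  ∀ j ∉ F, ∀ r s, Commute b (unitOp j r s)

lemma SupportedOn.mono {F G : Finset J} (h : F ⊆ G) {b : Space n →L[ℂ] Space n}
    (hb : SupportedOn F b) : SupportedOn G b :=
  fun j hj => hb j fun hF => hj (h hF)

/-- Only finitely many sites enter a ⋆-polynomial in the generators. -/
lemma exists_supportedOn {b : Space n →L[ℂ] Space n} (hb : b ∈ finiteSupport n) :
    ∃ F, SupportedOn F b := by
  induction hb using StarAlgebra.adjoin_induction with
  | mem b hb =>
    obtain ⟨k, a, rfl⟩ := Set.mem_iUnion.1 hb
    refine ⟨{k}, fun j hj r s => ?_⟩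
    rw [siteRep_apply]
    refine Commute.sum_left _ _ _ fun t _ => Commute.sum_left _ _ _ fun u _ => ?_
    exact (commute_unitOp (fun h => hj (by simp [h])) _ _ _ _).smul_left _
  | algebraMap c => exact ⟨∅, fun j _ r s => Algebra.commutes c _⟩
  | add x y _ _ hx hy =>
    obtain ⟨F, hF⟩ := hx
    obtain ⟨G, hG⟩ := hy
    exact ⟨F ∪ G, fun j hj r s => (hF.mono Finset.subset_union_left j hj r s).add_left
      (hG.mono Finset.subset_union_right j hj r s)⟩
  | mul x y _ _ hx hy =>
    obtain ⟨F, hF⟩ := hx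
    obtain ⟨G, hG⟩ := hy
    exact ⟨F ∪ G, fun j hj r s => (hF.mono Finset.subset_union_left j hj r s).mul_left
      (hG.mono Finset.subset_union_right j hj r s)⟩
  | star x _ hx =>
    obtain ⟨F, hF⟩ := hx
    refine ⟨F, fun j hj r s => ?_⟩
    have := (hF j hj s r).star_star
    rwa [star_unitOp] at this

lemma exists_common_support {ι : Type*} [Finite ι] {b : ι → Space n →L[ℂ] Space n}
    (hb : ∀ i, b i ∈ finiteSupport n) : ∃ F, ∀ i, SupportedOn F (b i) := by
  cases nonempty_fintype ι
  choose F hF using fun i => exists_supportedOn (hb i)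
  exact ⟨Finset.univ.biUnion F, fun i =>
    (hF i).mono (Finset.subset_biUnion_of_mem F (Finset.mem_univ i))⟩

/-- Tensor with one fresh site of dimension at least 2 at a time, which at least doubles the size.
-/
lemma exists_isMatrixUnits (hJ : {j | 2 ≤ n j}.Infinite) (F : Finset J) (N : ℕ) :
    ∃ (S : Type) (_ : Fintype S) (_ : DecidableEq S) (ε : S → S → Space n →L[ℂ] Space n),
      IsMatrixUnits ε ∧ 2 ^ N ≤ Fintype.card S ∧ (∀ s t, ε s t ∈ finiteSupport n) ∧
      ∀ b, SupportedOn F b → ∀ s t, Commute b (ε s t) := by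
  induction N with
  | zero =>
    exact ⟨Unit, inferInstance, inferInstance, fun _ _ => 1, ⟨by simp, by simp, by simp⟩, by simp,
      fun _ _ => one_mem _, fun b _ _ _ => Commute.one_right b⟩
  | succ N ih =>
    obtain ⟨S, i1, i2, ε, hε, hcard, hmem, hcomm⟩ := ih
    -- G supports the units already built, so a site outside F ∪ G commutes with them as well as
    -- with everything supported on F.
    obtain ⟨G, hG⟩ := exists_common_support (b := fun p : S × S => ε p.1 p.2)
      fun p => hmem p.1 p.2
    obtain ⟨j, hj2, hj⟩ := hJ.exists_notMem_finset (F ∪ G)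
    have hjF : j ∉ F := fun h => hj (Finset.mem_union_left _ h)
    have hjG : j ∉ G := fun h => hj (Finset.mem_union_right _ h)
    have hc (s t r u) : Commute (ε s t) (unitOp j r u) := hG (s, t) j hjG r u
    refine ⟨S × Fin (n j), inferInstance, inferInstance,
      fun p q => ε p.1 q.1 * unitOp j p.2 q.2, ⟨?_, ?_, ?_⟩, ?_, ?_, ?_⟩
    · rintro ⟨s, r⟩ ⟨s', r'⟩ ⟨t, u⟩ ⟨t', u'⟩
      dsimp only
      rw [(hc t t' r r').symm.mul_mul_mul_comm, hε.mul_eq, unitOp_mul]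
      by_cases h1 : s' = t <;> by_cases h2 : r' = u <;> simp [h1, h2]
    · rintro ⟨s, r⟩ ⟨s', r'⟩
      dsimp only
      rw [star_mul, star_unitOp, hε.star_eq, (hc s' s r' r).eq]
    · rw [Fintype.sum_prod_type]
      simp only [← Finset.mul_sum, sum_unitOp, mul_one, hε.sum_eq]
    · rw [Fintype.card_prod, Fintype.card_fin, pow_succ]
      exact Nat.mul_le_mul hcard hj2
    · exact fun p q => mul_mem (hmem _ _) (unitOp_mem _ _ _)
    · exact fun b hb p q => (hcomm b hb _ _).mul_right (hb j hjF _ _)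

end Support

theorem hasLengthLE_four {J : Type*} [DecidableEq J] (n : J → ℕ) [∀ j, NeZero (n j)]
    (hJ : {j | 2 ≤ n j}.Infinite) (I : Type*) :
    HasLengthLE (BddFamilies I (MatrixTensor n)) 4 := by
  refine hasLengthLE_four_bddFamilies fun m _ x δ hδ => ?_
  have happ (i j) : ∃ y : MatrixTensor n, y.1 ∈ finiteSupport n ∧ ‖x i j - y‖ ≤ δ := by
    obtain ⟨b, hb, hbd⟩ := Metric.mem_closure_iff.1 (x i j).2 δ hδ
    refine ⟨⟨b, subset_closure hb⟩, hb, ?_⟩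
    rw [dist_eq_norm] at hbd
    exact hbd.le
  choose y hy hxy using happ
  obtain ⟨F, hF⟩ := exists_common_support (b := fun p : Fin m × Fin m => (y p.1 p.2).1)
    fun p => hy p.1 p.2
  obtain ⟨S, i1, i2, ε, hε, hcard, hmem, hcomm⟩ := exists_isMatrixUnits hJ F m
  let ε' (s t : S) : MatrixTensor n := ⟨ε s t, subset_closure (hmem s t)⟩
  have hε' : IsMatrixUnits ε' := by
    refine ⟨fun i j k l => Subtype.ext ?_, fun i j => Subtype.ext (hε.star_eq i j),
      Subtype.ext ?_⟩
    · refine (hε.mul_eq i j k l).trans ?_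
      split_ifs <;> rfl
    · refine Eq.trans ?_ hε.sum_eq
      simp [ε']
  -- Adding m sites is enough because m < 2^m.
  obtain ⟨c, hc⟩ := hε'.exists_cover (n := m) (Nat.lt_two_pow_self.le.trans hcard)
  exact ⟨y, c, hxy, fun i j => hc _ fun s t => Subtype.ext (hcomm _ (hF (i, j)) s t).eq⟩

theorem length_le_five {J : Type*} [DecidableEq J] (n : J → ℕ) [∀ j, NeZero (n j)]
    (hJ : {j | 2 ≤ n j}.Infinite) (I : Type*) :
    OpLength.length (BddFamilies I (MatrixTensor n)) ≤ 5 :=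
  le_trans (sInf_le ⟨4, hasLengthLE_four n hJ I, rfl⟩) (by norm_num)

end InfTensor

theorem proposition21 :
    (∀ I : Type*, OpLength.length (BddFamilies I CARAlgebra) ≤ 5) ∧
    (∀ (J : Type*) [DecidableEq J] (n : J → ℕ) [∀ j, NeZero (n j)],
      {j | 2 ≤ n j}.Infinite →
        ∀ I : Type*, OpLength.length (BddFamilies I (MatrixTensor n)) ≤ 5) :=
  ⟨fun I => InfTensor.length_le_five _ (by simp [Set.infinite_univ]) I,
    fun _ _ n _ hJ I => InfTensor.length_le_five n hJ I⟩
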